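/- Let $G$ be a locally compact Hausdorff Abelian group, written additively, and let $\mathcal C(G)$ be the space of all continuous functions $G\to\mathbb C$ with the topology of uniform convergence on compact sets. A \emph{variety} on $G$ is a closed linear subspace $V$ of $\mathcal C(G)$ such that for every $f\in V$ and $y\in G$ the translate $x\mapsto f(x+y)$ belongs to $V$. An \emph{exponential monomial} on $G$ is a function of the form $x\mapsto P(a_1(x),\dots,a_k(x))\,m(x)$, where $P$ is a complex polynomial in $k$ variables, $a_1,\dots,a_k:G\to\mathbb C$ are continuous homomorphisms into the additive group of $\mathbb C$, and $m$ is a continuous homomorphism of $G$ into the multiplicative group of nonzero complex numbers. An element $x\in G$ is \emph{compact} if the smallest closed subgroup of $G$ containing $x$ is compact. If every element of $G$ is compact, then spectral synthesis holds on $G$, that is, for every variety $V$ on $G$ the linear span of the exponential monomials belonging to $V$ is dense in $V$. -/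

import Mathlib

namespace SpectralSynthesis

variable {G : Type*} [AddCommGroup G] [TopologicalSpace G] [IsTopologicalAddGroup G]

/-- The translate `x ↦ f (x + y)` of `f` by `y`. -/
noncomputable def translate (y : G) (f : C(G, ℂ)) : C(G, ℂ) :=
  ⟨fun x => f (x + y), by fun_prop⟩

/-- A variety: a translation invariant closed linear subspace of `C(G, ℂ)`, which carries the
compact-open topology, that is, the topology of uniform convergence on compact sets. -/
structure IsVariety (V : Submodule ℂ C(G, ℂ)) : Prop where
  isClosed : IsClosed (V : Set C(G, ℂ))
  translate_mem : ∀ (y : G), ∀ f ∈ V, translate y f ∈ V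

/-- An exponential: a continuous homomorphism of `G` into the multiplicative group of nonzero
complex numbers, viewed as a complex valued function. -/
def IsExponential (m : C(G, ℂ)) : Prop :=
  (∀ x, m x ≠ 0) ∧ ∀ x y, m (x + y) = m x * m y

/-- An exponential monomial: `x ↦ P (a₁ x, …, a_k x) * m x`, where `P` is a complex polynomial in
`k` variables, the `a_i` are additive functions (continuous additive homomorphisms `G → ℂ`) and
`m` is an exponential. -/
def IsExponentialMonomial (f : C(G, ℂ)) : Prop :=
  ∃ (k : ℕ) (P : MvPolynomial (Fin k) ℂ) (a : Fin k → (G →ₜ+ ℂ)) (m : C(G, ℂ)),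
    IsExponential m ∧ ∀ x, f x = MvPolynomial.eval (fun i => a i x) P * m x

/-- `V` is synthesizable: the exponential monomials in `V` span a dense subspace of `V`. -/
def IsSynthesizable (V : Submodule ℂ C(G, ℂ)) : Prop :=
  (V : Set C(G, ℂ)) ⊆
    closure (Submodule.span ℂ {f : C(G, ℂ) | f ∈ V ∧ IsExponentialMonomial f} : Set C(G, ℂ))

variable (G) in
/-- Spectral synthesis holds on `G`: every variety on `G` is synthesizable. -/
def HoldsOn : Prop :=
  ∀ V : Submodule ℂ C(G, ℂ), IsVariety V → IsSynthesizable V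

/-- A compact element: the smallest closed subgroup containing it is compact. -/
def IsCompactElem (x : G) : Prop :=
  IsCompact ((AddSubgroup.zmultiples x).topologicalClosure : Set G)

end SpectralSynthesis

/-!
Since every element of `G` is compact, every compact subset of `G` lies in a compact open subgroup
`K` (`exists_isOpen_isCompact_addSubgroup`): if `S` is a symmetric compact neighbourhood of `0`,
then `S + S ⊆ t + S` for a finite set `t`, so the open subgroup generated by `S` is contained in
`S + ⟨t⟩`, and `⟨t⟩` lies in a finite sum of compact groups. Given a variety `V` and `f ∈ V`, it
therefore suffices to approximate `f` uniformly on such a `K`.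

On the compact group `K`, the restriction of `f` is a uniform limit of linear combinations of those
exponentials `ψ` of `K` for which the Fourier coefficient `∫ f(k) ψ(-k) dk` does not vanish
(`mem_closure_span_isExponential`). This is harmonic analysis on compact abelian groups, resting on
the completeness of the exponentials (`exists_isExponential_integral_ne_zero`). Completeness comes
from Gelfand theory: for `c ≠ 0` in `C(K)`, the product `T` of the convolution operator of `c` and its
`L²`-adjoint lies in the commutative Banach algebra of operators on `C(K)` that commute with
everything commuting with translations. The operator `T` is `L²`-symmetric and nonzero, so that
`‖Tⁿ u‖₂` is log-convex in `n` and grows at least geometrically; hence `T` has positive spectral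
radius and some character `φ` of the algebra does not vanish at it. The values of `φ` at the
translations form an exponential.

Each such `ψ` extends to an exponential `m` of `G` that belongs to `V`
(`IsVariety.exists_isExponential_extension`). The average `x ↦ ∫ f(x + k) ψ(-k) dk` is a nonzero
element of the space `W` of those `g ∈ V` with `g(x + k) = ψ(k) g(x)` for `k ∈ K`. As `K` is open
and elements of `G` are compact, every `y ∈ G` has a multiple in `K`, so translation by `y` is
integral over `ℂ` on `W`. The commutative algebra generated by these translations is thus integral
over `ℂ`, and the quotient by a maximal ideal is `ℂ`; the images of the translations define `m`.
Any linear relation between the values of all elements of `W` at finitely many points is a relation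
between translations, hence holds for `m`; so `m` agrees with elements of `W` on finite sets, and
even on finite unions of cosets of `K`, whence `m` lies in the closure of `V`.

Additive functions do not enter: the approximating exponential monomials are exponentials.
-/

namespace SpectralSynthesis

open MeasureTheory Filter Topology
open scoped ComplexConjugate InnerProductSpace Pointwise

/-! ### Characters of commutative Banach algebras -/

/-- If the powers of `a` grow at least geometrically, then `a` has positive spectral radius, so some
character does not vanish at `a`. -/
theorem exists_algHom_apply_ne_zero {A : Type*} [NormedCommRing A] [NormedAlgebra ℂ A]
    [CompleteSpace A] (a : A) {c r : ℝ} (hc : 0 < c) (hr : 0 < r)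
    (h : ∀ n : ℕ, c * r ^ n ≤ ‖a ^ n‖) :
    ∃ φ : A →ₐ[ℂ] ℂ, Continuous φ ∧ φ a ≠ 0 := by
  have : Nontrivial A := by
    refine nontrivial_of_ne (1 : A) 0 fun h0 => ?_
    have := h 0
    simp [h0] at this
    linarith
  by_contra! hφ
  have hspec : ∀ z ∈ spectrum ℂ a, z = 0 := by
    intro z hz
    obtain ⟨f, hf⟩ := WeakDual.CharacterSpace.mem_spectrum_iff_exists.1 hz
    rw [← hf]
    exact hφ (WeakDual.CharacterSpace.toAlgHom f) (map_continuous f)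
  have hrad : spectralRadius ℂ a = 0 := by
    obtain ⟨z, hz, hz'⟩ := spectrum.exists_nnnorm_eq_spectralRadius a
    rw [← hz', hspec z hz]; simp
  have hlim := spectrum.pow_norm_pow_one_div_tendsto_nhds_spectralRadius a
  rw [hrad] at hlim
  have hlim' : Tendsto (fun n : ℕ => ‖a ^ n‖ ^ (1 / n : ℝ)) atTop (𝓝 0) := by
    have := (ENNReal.tendsto_toReal ENNReal.zero_ne_top).comp hlim
    refine this.congr fun n => ?_
    simp only [Function.comp]
    rw [ENNReal.toReal_ofReal (by positivity)]
  have hlow : Tendsto (fun n : ℕ => c ^ (1 / n : ℝ) * r) atTop (𝓝 r) := by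
    have h1 : Tendsto (fun n : ℕ => c ^ (1 / n : ℝ)) atTop (𝓝 (c ^ (0 : ℝ))) :=
      tendsto_const_nhds.rpow (tendsto_one_div_atTop_nhds_zero_nat (𝕜 := ℝ)) (Or.inl hc.ne')
    simpa using h1.mul_const r
  refine absurd (le_of_tendsto_of_tendsto hlow hlim' ?_) (not_le.2 hr)
  filter_upwards [eventually_ne_atTop 0] with n hn
  calc c ^ (1 / n : ℝ) * r = (c * r ^ n) ^ (1 / n : ℝ) := by
        rw [Real.mul_rpow hc.le (by positivity), one_div, Real.pow_rpow_inv_natCast hr.le hn]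
    _ ≤ _ := Real.rpow_le_rpow (by positivity) (h n) (by positivity)

/-- The bicommutant of a set in a normed algebra. It is closed, contains the set, and is
commutative if the elements of the set commute with each other. -/
noncomputable abbrev bicommutant {B : Type*} [NormedRing B] [NormedAlgebra ℂ B] (s : Set B) :
    Subalgebra ℂ B :=
  Subalgebra.centralizer ℂ (Set.centralizer s)

theorem exists_bicommutant_algHom {B : Type*} [NormedRing B] [NormedAlgebra ℂ B] [CompleteSpace B]
    {s : Set B} (hs : ∀ x ∈ s, ∀ y ∈ s, x * y = y * x) (a : bicommutant s) {c r : ℝ} (hc : 0 < c)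
    (hr : 0 < r) (h : ∀ n : ℕ, c * r ^ n ≤ ‖(a : B) ^ n‖) :
    ∃ φ : bicommutant s →ₐ[ℂ] ℂ, Continuous φ ∧ φ a ≠ 0 := by
  have hsub : s ⊆ Set.centralizer s := fun x hx y hy => hs y hy x hx
  let _ : NormedCommRing (bicommutant s) :=
    { (inferInstance : NormedRing (bicommutant s)) with
      mul_comm := fun x y => Subtype.ext
        (y.2 (x : B) (Set.centralizer_subset hsub x.2)) }
  have : CompleteSpace (bicommutant s) :=
    (Set.isClosed_centralizer (Set.centralizer s)).completeSpace_coe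
  exact exists_algHom_apply_ne_zero a hc hr fun n => h n

/-- A log-convex sequence whose first two terms are positive grows at least geometrically. -/
theorem geometric_le_of_sq_le {b : ℕ → ℝ} (h0 : 0 < b 0) (h1 : 0 < b 1)
    (h : ∀ n, b (n + 1) ^ 2 ≤ b (n + 2) * b n) (n : ℕ) :
    b 0 * (b 1 / b 0) ^ n ≤ b n := by
  have key : ∀ n, 0 < b n ∧ b 1 / b 0 * b n ≤ b (n + 1) := by
    intro n
    induction n with
    | zero => exact ⟨h0, by rw [div_mul_cancel₀ _ h0.ne']⟩
    | succ n ih =>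
      have hpos : 0 < b (n + 1) := lt_of_lt_of_le (by have := ih.1; positivity) ih.2
      refine ⟨hpos, le_of_mul_le_mul_right ?_ ih.1⟩
      calc b 1 / b 0 * b (n + 1) * b n = b 1 / b 0 * b n * b (n + 1) := by ring
        _ ≤ b (n + 1) * b (n + 1) := by gcongr; exact ih.2
        _ ≤ _ := by rw [← sq]; exact h n
  induction n with
  | zero => simp
  | succ n ih =>
    calc b 0 * (b 1 / b 0) ^ (n + 1) = b 1 / b 0 * (b 0 * (b 1 / b 0) ^ n) := by ring
      _ ≤ b 1 / b 0 * b n := by gcongr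
      _ ≤ _ := (key n).2

/-- An algebra generated by commuting integral elements is integral over `ℂ`, so its residue field at
any maximal ideal is `ℂ`. -/
theorem nonempty_algHom_adjoin_of_isIntegral {B : Type*} [Ring B] [Algebra ℂ B] [Nontrivial B]
    {s : Set B} (hcomm : ∀ a ∈ s, ∀ b ∈ s, a * b = b * a) (hint : ∀ a ∈ s, IsIntegral ℂ a) :
    Nonempty (Algebra.adjoin ℂ s →ₐ[ℂ] ℂ) := by
  have hmul := (Algebra.isMulCommutative_adjoin ℂ hcomm).is_comm.comm
  let _ : CommRing (Algebra.adjoin ℂ s) :=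
    { (inferInstance : Ring (Algebra.adjoin ℂ s)) with mul_comm := hmul }
  have hA : Algebra.IsIntegral ℂ (Algebra.adjoin ℂ s) := by
    refine ⟨fun a => ?_⟩
    obtain ⟨a, ha⟩ := a
    induction ha using Algebra.adjoin_induction with
    | mem x hx =>
      exact (isIntegral_algHom_iff (Algebra.adjoin ℂ s).val Subtype.val_injective).1 (hint x hx)
    | algebraMap r => exact isIntegral_algebraMap (R := ℂ) (A := Algebra.adjoin ℂ s) (x := r)
    | add x y hx hy h1 h2 => exact h1.add h2
    | mul x y hx hy h1 h2 => exact h1.mul h2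
  obtain ⟨M, hM⟩ := Ideal.exists_maximal (Algebra.adjoin ℂ s)
  let _ : Field (Algebra.adjoin ℂ s ⧸ M) := Ideal.Quotient.field M
  have hbij := IsAlgClosed.algebraMap_bijective_of_isIntegral
    (k := ℂ) (K := Algebra.adjoin ℂ s ⧸ M)
  exact ⟨((AlgEquiv.ofBijective (Algebra.ofId ℂ _) hbij).symm : _ →ₐ[ℂ] ℂ).comp
    (Ideal.Quotient.mkₐ ℂ M)⟩

/-! ### Preliminaries on integrals, exponentials and uniform approximation -/

theorem integrable_of_continuous {E X : Type*} [TopologicalSpace X] [CompactSpace X]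
    [MeasurableSpace X] [OpensMeasurableSpace X] [NormedAddCommGroup E] {μ : Measure X}
    [IsFiniteMeasureOnCompacts μ] {F : X → E} (hF : Continuous F) : Integrable F μ :=
  hF.integrable_of_hasCompactSupport (HasCompactSupport.of_compactSpace F)

theorem toLp_ne_zero {X : Type*} [TopologicalSpace X] [CompactSpace X] [MeasurableSpace X]
    [BorelSpace X] (μ : Measure X) [IsFiniteMeasure μ] [μ.IsOpenPosMeasure] {u : C(X, ℂ)}
    (hu : u ≠ 0) : ContinuousMap.toLp 2 μ ℂ u ≠ 0 := by
  rw [← map_zero (ContinuousMap.toLp 2 μ ℂ)]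
  exact (ContinuousMap.toLp_injective μ).ne hu

theorem IsExponential.map_zero {G : Type*} [AddCommGroup G] [TopologicalSpace G]
    {m : C(G, ℂ)} (hm : IsExponential m) : m 0 = 1 := by
  have := hm.2 0 0
  rw [add_zero] at this
  exact (mul_eq_left₀ (hm.1 0)).1 this.symm

theorem IsExponential.map_neg {G : Type*} [AddCommGroup G] [TopologicalSpace G]
    {m : C(G, ℂ)} (hm : IsExponential m) (x : G) : m (-x) = (m x)⁻¹ := by
  rw [← mul_eq_one_iff_eq_inv₀ (hm.1 x), ← hm.2, neg_add_cancel, hm.map_zero]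

theorem IsExponential.isExponentialMonomial {G : Type*} [AddCommGroup G] [TopologicalSpace G]
    {m : C(G, ℂ)} (hm : IsExponential m) : IsExponentialMonomial m :=
  ⟨0, 1, Fin.elim0, m, hm, fun x => by simp⟩

theorem IsExponential.comp_neg {G : Type*} [AddCommGroup G] [TopologicalSpace G]
    [IsTopologicalAddGroup G] {m : C(G, ℂ)} (hm : IsExponential m) :
    IsExponential (⟨fun x => m (-x), by fun_prop⟩ : C(G, ℂ)) :=
  ⟨fun x => hm.1 (-x), fun x y => by simp [hm.2, mul_comm]⟩

theorem mem_closure_of_forall_isCompact {X : Type*} [TopologicalSpace X] {f : C(X, ℂ)}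
    {S : Set C(X, ℂ)}
    (h : ∀ C : Set X, IsCompact C → ∀ ε > 0, ∃ g ∈ S, ∀ x ∈ C, dist (f x) (g x) < ε) :
    f ∈ closure S := by
  rw [mem_closure_iff_nhds_basis (nhds_basis_uniformity'
    (Metric.uniformity_basis_dist.compactConvergenceUniformity (α := X) (β := ℂ)))]
  rintro ⟨C, ε⟩ ⟨hC, hε⟩
  obtain ⟨g, hg, hlt⟩ := h C hC ε hε
  exact ⟨g, hg, fun x hx => hlt x hx⟩

/-! ### Translation and convolution operators on a compact group -/

section Compact

variable {K : Type*} [AddCommGroup K] [TopologicalSpace K] [IsTopologicalAddGroup K]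

/-- The function `y ↦ conj (c (-y))`, for which `convCLM` yields the `L²`-adjoint of `convCLM μ c`. -/
noncomputable def involution (c : C(K, ℂ)) : C(K, ℂ) := ⟨fun y => conj (c (-y)), by fun_prop⟩

@[simp] theorem involution_apply (c : C(K, ℂ)) (y : K) : involution c y = conj (c (-y)) := rfl

@[simp] theorem involution_involution (c : C(K, ℂ)) : involution (involution c) = c := by
  ext y; simp

variable [CompactSpace K]

variable (K) in
/-- Translation by `y` as a bounded operator on `C(K, ℂ)`. -/
noncomputable def translationCLM (y : K) : C(K, ℂ) →L[ℂ] C(K, ℂ) :=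
  LinearMap.mkContinuous
    { toFun := translate y
      map_add' := fun _ _ => rfl
      map_smul' := fun _ _ => rfl } 1 fun f => by
    rw [one_mul]
    exact (ContinuousMap.norm_le _ (norm_nonneg _)).2 fun x => f.norm_coe_le_norm (x + y)

@[simp] theorem translationCLM_apply (y : K) (f : C(K, ℂ)) (x : K) :
    translationCLM K y f x = f (x + y) := rfl

theorem translationCLM_add (y z : K) :
    translationCLM K (y + z) = translationCLM K y * translationCLM K z := by
  ext f x
  simp [add_assoc]

theorem translationCLM_zero : translationCLM K 0 = 1 := by
  ext f x
  simp

theorem continuous_translationCLM_apply (f : C(K, ℂ)) :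
    Continuous fun y : K => translationCLM K y f :=
  ContinuousMap.continuous_of_continuous_uncurry _ (by
    change Continuous fun p : K × K => f (p.2 + p.1)
    fun_prop)

variable (K) in
/-- The bicommutant of the translations in the bounded operators on `C(K, ℂ)`: a commutative Banach
algebra that contains the translations and the operators `convCLM μ c`. -/
noncomputable abbrev translationAlgebra : Subalgebra ℂ (C(K, ℂ) →L[ℂ] C(K, ℂ)) :=
  bicommutant (Set.range (translationCLM K))

theorem translationCLM_mem (y : K) : translationCLM K y ∈ translationAlgebra K :=
  Set.subset_centralizer_centralizer (Set.mem_range_self y)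

theorem translationCLM_commute : ∀ x ∈ Set.range (translationCLM K),
    ∀ y ∈ Set.range (translationCLM K), x * y = y * x := by
  rintro _ ⟨y, rfl⟩ _ ⟨z, rfl⟩
  rw [← translationCLM_add, ← translationCLM_add, add_comm]

variable [MeasurableSpace K] [BorelSpace K] (μ : Measure K) [μ.IsAddHaarMeasure]

theorem integrable_smul_translation (c f : C(K, ℂ)) :
    Integrable (fun y => c y • translationCLM K y f) μ :=
  integrable_of_continuous ((map_continuous c).smul (continuous_translationCLM_apply f))

/-- The operator `∫ c y • U_y ∂μ`, where `U_y` is the translation by `y`. It is the convolution with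
the reflection of `c`: its value at `f` is `x ↦ ∫ c y * f (x + y) ∂μ`. -/
noncomputable def convCLM : C(K, ℂ) →L[ℂ] C(K, ℂ) →L[ℂ] C(K, ℂ) :=
  LinearMap.mkContinuous₂
    (LinearMap.mk₂ ℂ (fun c f => ∫ y, c y • translationCLM K y f ∂μ)
      (fun c d f => by
        rw [← integral_add (integrable_smul_translation μ c f) (integrable_smul_translation μ d f)]
        simp [add_smul])
      (fun a c f => by
        rw [← integral_smul]
        simp [mul_smul])
      (fun c f g => by
        rw [← integral_add (integrable_smul_translation μ c f) (integrable_smul_translation μ c g)]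
        simp)
      (fun a c f => by
        rw [← integral_smul]
        simp [smul_comm a])) (μ.real Set.univ) fun c f => by
    refine (norm_integral_le_of_norm_le_const (μ := μ) (C := ‖c‖ * ‖f‖) (.of_forall fun y => ?_)).trans
      (le_of_eq (by ring))
    rw [norm_smul]
    gcongr
    · exact c.norm_coe_le_norm y
    · exact (ContinuousMap.norm_le _ (norm_nonneg _)).2 fun x => f.norm_coe_le_norm (x + y)

theorem convCLM_eq (c f : C(K, ℂ)) : convCLM μ c f = ∫ y, c y • translationCLM K y f ∂μ := rfl

/-- A bounded operator may be moved under the integral defining `convCLM`. -/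
theorem map_convCLM {E : Type*} [NormedAddCommGroup E] [NormedSpace ℂ E] [CompleteSpace E]
    (L : C(K, ℂ) →L[ℂ] E) (c f : C(K, ℂ)) :
    L (convCLM μ c f) = ∫ y, c y • L (translationCLM K y f) ∂μ := by
  rw [convCLM_eq, ← L.integral_comp_comm (integrable_smul_translation μ c f)]
  simp

theorem convCLM_apply (c f : C(K, ℂ)) (x : K) :
    convCLM μ c f x = ∫ y, c y * f (x + y) ∂μ := by
  simpa using map_convCLM μ (ContinuousMap.evalCLM ℂ x) c f

theorem convCLM_mem (c : C(K, ℂ)) : convCLM μ c ∈ translationAlgebra K := by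
  intro T hT
  ext1 f
  have hT' : ∀ y, T (translationCLM K y f) = translationCLM K y (T f) := fun y =>
    (DFunLike.congr_fun (hT _ ⟨y, rfl⟩) f).symm
  change T (convCLM μ c f) = convCLM μ c (T f)
  rw [map_convCLM, convCLM_eq]
  simp [hT']

theorem translationCLM_mul_convCLM (z : K) (c : C(K, ℂ)) :
    translationCLM K z * convCLM μ c = convCLM μ (translationCLM K (-z) c) := by
  ext f x
  change convCLM μ c f (x + z) = _
  rw [convCLM_apply, convCLM_apply,
    ← integral_add_left_eq_self (fun y => translationCLM K (-z) c y * f (x + y)) z]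
  simp [add_assoc]

/-! ### Completeness of the exponentials of a compact group -/

theorem inner_toLp_translationCLM (y : K) (u v : C(K, ℂ)) :
    ⟪ContinuousMap.toLp 2 μ ℂ v, ContinuousMap.toLp 2 μ ℂ (translationCLM K y u)⟫_ℂ =
      ⟪ContinuousMap.toLp 2 μ ℂ (translationCLM K (-y) v), ContinuousMap.toLp 2 μ ℂ u⟫_ℂ := by
  rw [ContinuousMap.inner_toLp, ContinuousMap.inner_toLp,
    ← integral_add_right_eq_self (fun x => u x * conj (translationCLM K (-y) v x)) y]
  simp

theorem inner_toLp_convCLM [μ.IsNegInvariant] (c u v : C(K, ℂ)) :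
    ⟪ContinuousMap.toLp 2 μ ℂ v, ContinuousMap.toLp 2 μ ℂ (convCLM μ c u)⟫_ℂ =
      ⟪ContinuousMap.toLp 2 μ ℂ (convCLM μ (involution c) v), ContinuousMap.toLp 2 μ ℂ u⟫_ℂ := by
  have key : ∀ c u v : C(K, ℂ),
      ⟪ContinuousMap.toLp 2 μ ℂ v, ContinuousMap.toLp 2 μ ℂ (convCLM μ c u)⟫_ℂ =
        ∫ y, c y * ⟪ContinuousMap.toLp 2 μ ℂ v,
          ContinuousMap.toLp 2 μ ℂ (translationCLM K y u)⟫_ℂ ∂μ := fun c u v =>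
    map_convCLM μ ((innerSL ℂ (ContinuousMap.toLp 2 μ ℂ v)).comp (ContinuousMap.toLp 2 μ ℂ)) c u
  rw [← inner_conj_symm (ContinuousMap.toLp 2 μ ℂ (convCLM μ (involution c) v)), key, key,
    ← integral_conj, ← integral_neg_eq_self]
  refine integral_congr_ae (.of_forall fun y => ?_)
  simp [inner_toLp_translationCLM]

/-- With `T` the product of `convCLM μ c` and its `L²`-adjoint, symmetry and the Cauchy-Schwarz
inequality give `‖T ^ (n + 1) u‖₂ ^ 2 ≤ ‖T ^ (n + 2) u‖₂ * ‖T ^ n u‖₂`, and the sup norm dominates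
the `L²` norm up to a constant. -/
theorem exists_geometric_le_norm_pow [μ.IsNegInvariant] {c : C(K, ℂ)} (hc : c ≠ 0) :
    ∃ a r : ℝ, 0 < a ∧ 0 < r ∧
      ∀ n : ℕ, a * r ^ n ≤ ‖(convCLM μ c * convCLM μ (involution c)) ^ n‖ := by
  set T := convCLM μ c * convCLM μ (involution c) with hT
  let J := ContinuousMap.toLp (E := ℂ) 2 μ ℂ
  have hsymm : ∀ u v, ⟪J v, J (T u)⟫_ℂ =
      ⟪J (convCLM μ (involution c) v), J (convCLM μ (involution c) u)⟫_ℂ := fun u v =>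
    inner_toLp_convCLM μ c _ v
  have hsymm' : ∀ u v, ⟪J v, J (T u)⟫_ℂ = ⟪J (T v), J u⟫_ℂ := fun u v => by
    rw [hsymm, ← inner_conj_symm (J (T v)), hsymm, inner_conj_symm]
  obtain ⟨u, hu⟩ : ∃ u, convCLM μ (involution c) u ≠ 0 := by
    -- The value at `0` of the image of this function is the squared `L²` norm of `involution c`.
    refine ⟨star (involution c), fun h0 => ?_⟩
    have hne : involution c ≠ 0 := fun h0 => hc (by
      rw [← involution_involution c, h0]; ext; simp)
    have h1 := inner_self_ne_zero (𝕜 := ℂ).2 (toLp_ne_zero μ hne)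
    rw [ContinuousMap.inner_toLp] at h1
    apply h1
    have := convCLM_apply μ (involution c) (star (involution c)) 0
    rw [h0] at this
    simpa using this.symm
  have hJu : J (T u) ≠ 0 := fun h0 => by
    have := hsymm u u
    rw [h0, inner_zero_right] at this
    exact inner_self_ne_zero.2 (toLp_ne_zero μ hu) this.symm
  have hJu0 : J u ≠ 0 := fun h0 => by
    have := hsymm' u u
    have h2 := hsymm u u
    rw [this, h0, inner_zero_right] at h2
    exact inner_self_ne_zero.2 (toLp_ne_zero μ hu) h2.symm
  have hgeo := geometric_le_of_sq_le (b := fun n => ‖J ((T ^ n) u)‖) (by simpa using hJu0)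
    (by simpa using hJu) (fun n => by
      have h1 : (T ^ (n + 1)) u = T ((T ^ n) u) := by rw [pow_succ']; rfl
      have h2 : (T ^ (n + 2)) u = T (T ((T ^ n) u)) := by rw [pow_succ', pow_succ']; rfl
      simp only [h1, h2]
      rw [← inner_self_eq_norm_sq (𝕜 := ℂ), hsymm']
      exact (RCLike.re_le_norm _).trans (norm_inner_le_norm _ _))
  have hle : ∀ n, ‖J ((T ^ n) u)‖ ≤ ‖(T ^ n)‖ * (‖J‖ * ‖u‖) := fun n => by
    calc ‖J ((T ^ n) u)‖ ≤ ‖J‖ * (‖T ^ n‖ * ‖u‖) := (J.le_opNorm _).trans (by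
          gcongr; exact (T ^ n).le_opNorm u)
      _ = _ := by ring
  have hu0 : 0 < ‖J u‖ := norm_pos_iff.2 hJu0
  have hpos : 0 < ‖J‖ * ‖u‖ := hu0.trans_le (J.le_opNorm u)
  refine ⟨‖J u‖ / (‖J‖ * ‖u‖), ‖J (T u)‖ / ‖J u‖, by positivity,
    div_pos (norm_pos_iff.2 hJu) hu0, fun n => ?_⟩
  rw [div_mul_eq_mul_div, div_le_iff₀ hpos]
  exact (by simpa using hgeo n : _ ≤ _).trans (hle n)

/-- Completeness of the exponentials: a continuous function on a compact abelian group whose Fourier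
coefficients all vanish is zero. With `U y` the translation by `y`, the exponential is `y ↦ φ (U y)`
for a character `φ` of the translation algebra that does not vanish at `C = convCLM μ c`. It is
continuous because `y ↦ U y * C` is norm continuous, and `φ C` is its integral against `c`. -/
theorem exists_isExponential_integral_ne_zero [μ.IsNegInvariant] {c : C(K, ℂ)}
    (hc : c ≠ 0) :
    ∃ χ : C(K, ℂ), IsExponential χ ∧ ∫ y, c y * χ y ∂μ ≠ 0 := by
  obtain ⟨a, r, ha, hr, h⟩ := exists_geometric_le_norm_pow μ hc
  let A := translationAlgebra K
  have : CompleteSpace A := (Set.isClosed_centralizer (Set.centralizer _)).completeSpace_coe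
  let C : C(K, ℂ) → A := fun c => ⟨convCLM μ c, convCLM_mem μ c⟩
  let U : K → A := fun y => ⟨translationCLM K y, translationCLM_mem y⟩
  obtain ⟨φ, hφ, hφT⟩ := exists_bicommutant_algHom translationCLM_commute
    (C c * C (involution c)) ha hr h
  have hφc : φ (C c) ≠ 0 := fun h0 => hφT (by rw [map_mul, h0, zero_mul])
  have hU0 : U 0 = 1 := Subtype.ext translationCLM_zero
  have hUadd : ∀ y z, U (y + z) = U y * U z := fun y z => Subtype.ext (translationCLM_add y z)
  have hUC : ∀ y, U y * C c = C (translationCLM K (-y) c) := fun y =>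
    Subtype.ext (translationCLM_mul_convCLM μ y c)
  have hUCcont : Continuous fun y => U y * C c := by
    simp only [hUC]
    exact ((convCLM μ).continuous.comp
      ((continuous_translationCLM_apply c).comp continuous_neg)).subtype_mk _
  have hcont : Continuous fun y => φ (U y) := by
    have h1 : ∀ y, φ (U y) = φ (U y * C c) / φ (C c) := fun y => by
      rw [map_mul, mul_div_cancel_right₀ _ hφc]
    simp only [h1]
    exact (hφ.comp hUCcont).div_const _
  refine ⟨⟨fun y => φ (U y), hcont⟩, ⟨fun y h0 => ?_, fun y z => ?_⟩, fun h0 => ?_⟩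
  · have : φ (U (y + -y)) = 1 := by rw [add_neg_cancel, hU0, map_one]
    rw [hUadd, map_mul] at this
    exact left_ne_zero_of_mul_eq_one this h0
  · change φ (U (y + z)) = φ (U y) * φ (U z)
    rw [hUadd, map_mul]
  · have hint : Integrable (fun y => c y • (U y * C c)) μ :=
      integrable_of_continuous ((map_continuous c).smul hUCcont)
    -- `y ↦ U y` need not be norm continuous, so `φ` is applied to `C * C = ∫ c y • (U y * C)` instead
    -- of `C = ∫ c y • U y`.
    have hCC : C c * C c = ∫ y, c y • (U y * C c) ∂μ := by
      refine Subtype.ext ?_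
      ext1 f
      let L : A →L[ℂ] C(K, ℂ) :=
        (ContinuousLinearMap.apply ℂ C(K, ℂ) f).comp (Subalgebra.toSubmodule A).subtypeL
      change convCLM μ c (convCLM μ c f) = L (∫ y, c y • (U y * C c) ∂μ)
      exact
        ContinuousLinearMap.integral_comp_comm (𝕜 := ℂ) (E := A) (Fₗ := C(K, ℂ)) L hint
    let Φ : A →L[ℂ] ℂ := ⟨φ.toLinearMap, hφ⟩
    have h1 : φ (C c * C c) = ∫ y, Φ (c y • (U y * C c)) ∂μ := by
      rw [ContinuousLinearMap.integral_comp_comm (𝕜 := ℂ) (E := A) (Fₗ := ℂ) Φ hint, ← hCC]; rfl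
    have h2 : ∀ y, Φ (c y • (U y * C c)) = c y * φ (U y) * φ (C c) := fun y => by
      change φ (c y • (U y * C c)) = _
      rw [map_smul, map_mul, smul_eq_mul, mul_assoc]
    simp only [h2] at h1
    have h0' : ∫ y, c y * φ (U y) ∂μ = 0 := h0
    rw [integral_mul_const, map_mul, h0', zero_mul] at h1
    exact hφc (mul_self_eq_zero.1 h1)

/-! ### Spectral synthesis on a compact group -/

variable (K) in
/-- The star subalgebra of trigonometric polynomials, that is, the linear span of the exponentials;
it is closed under products and conjugation because the set of exponentials is. -/
noncomputable def trigonometric : StarSubalgebra ℂ C(K, ℂ) where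
  carrier := Submodule.span ℂ {χ : C(K, ℂ) | IsExponential χ}
  zero_mem' := Submodule.zero_mem _
  add_mem' := Submodule.add_mem _
  mul_mem' {f g} hf hg := by
    refine Submodule.span_induction₂ (p := fun f g _ _ =>
      f * g ∈ Submodule.span ℂ {χ : C(K, ℂ) | IsExponential χ}) ?_ ?_ ?_ ?_ ?_ ?_ ?_ hf hg
    · intro χ ψ hχ hψ
      refine Submodule.subset_span ⟨fun x => mul_ne_zero (hχ.1 x) (hψ.1 x), fun x y => ?_⟩
      simp only [ContinuousMap.mul_apply, hχ.2, hψ.2]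
      ring
    · intros; simp
    · intros; simp
    · intro _ _ _ _ _ _ h1 h2
      rw [add_mul]; exact add_mem h1 h2
    · intro _ _ _ _ _ _ h1 h2
      rw [mul_add]; exact add_mem h1 h2
    · intro _ _ _ _ _ h
      rw [smul_mul_assoc]; exact Submodule.smul_mem _ _ h
    · intro _ _ _ _ _ h
      rw [mul_smul_comm]; exact Submodule.smul_mem _ _ h
  algebraMap_mem' r := by
    have h1 : IsExponential (1 : C(K, ℂ)) := ⟨fun _ => one_ne_zero, fun _ _ => (one_mul 1).symm⟩
    have := Submodule.smul_mem (Submodule.span ℂ {χ : C(K, ℂ) | IsExponential χ}) r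
      (Submodule.subset_span h1)
    rwa [← Algebra.algebraMap_eq_smul_one] at this
  star_mem' {f} hf := by
    refine Submodule.span_induction (p := fun f _ =>
      star f ∈ Submodule.span ℂ {χ : C(K, ℂ) | IsExponential χ}) ?_ ?_ ?_ ?_ hf
    · intro χ hχ
      refine Submodule.subset_span ⟨fun x => ?_, fun x y => ?_⟩
      · simpa using hχ.1 x
      · simp [hχ.2]
    · simp
    · intro _ _ _ _ h1 h2
      rw [star_add]; exact add_mem h1 h2
    · intro _ _ _ h
      rw [star_smul]; exact Submodule.smul_mem _ _ h

/-- Exponentials separate the points of a compact abelian group. If `χ x = χ y`, then the coefficient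
of `χ` vanishes for every difference of a function and its translate by `x - y`. -/
theorem exists_isExponential_ne [T2Space K] [μ.IsNegInvariant] {x y : K} (hxy : x ≠ y) :
    ∃ χ : C(K, ℂ), IsExponential χ ∧ χ x ≠ χ y := by
  obtain ⟨f, hf0, hf1, -⟩ := exists_continuous_zero_one_of_isClosed
    (isClosed_singleton (x := x)) (isClosed_singleton (x := y)) (by simpa using hxy)
  let u : C(K, ℂ) := ⟨fun z => (f z : ℂ), by fun_prop⟩
  have hc : translationCLM K (x - y) u - u ≠ 0 := fun h0 => by
    have := DFunLike.congr_fun h0 y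
    simp [u, hf0 (Set.mem_singleton x), hf1 (Set.mem_singleton y)] at this
  obtain ⟨χ, hχ, hne⟩ := exists_isExponential_integral_ne_zero μ hc
  refine ⟨χ, hχ, fun h => hne ?_⟩
  have h1 : ∀ z, χ (z + (x - y)) = χ z := fun z => by
    rw [hχ.2, sub_eq_add_neg, hχ.2, hχ.map_neg, h, mul_inv_cancel₀ (hχ.1 y), mul_one]
  have hi : ∀ v : C(K, ℂ), Integrable (fun z => v z * χ z) μ := fun v =>
    integrable_of_continuous (by fun_prop)
  calc ∫ z, (translationCLM K (x - y) u - u) z * χ z ∂μ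
      = ∫ z, u (z + (x - y)) * χ (z + (x - y)) ∂μ - ∫ z, u z * χ z ∂μ := by
        simp only [h1]
        refine Eq.trans ?_ (integral_sub (hi (translationCLM K (x - y) u)) (hi u))
        simp [sub_mul]
    _ = 0 := by rw [integral_add_right_eq_self (fun z => u z * χ z), sub_self]

theorem dense_span_isExponential [T2Space K] [μ.IsNegInvariant] :
    Dense (Submodule.span ℂ {χ : C(K, ℂ) | IsExponential χ} : Set C(K, ℂ)) := by
  have h := ContinuousMap.starSubalgebra_topologicalClosure_eq_top_of_separatesPoints
    (trigonometric K) (fun x y hxy => by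
      obtain ⟨χ, hχ, hne⟩ := exists_isExponential_ne μ hxy
      exact ⟨χ, ⟨χ, Submodule.subset_span hχ, rfl⟩, hne⟩)
  intro f
  have : f ∈ (trigonometric K).topologicalClosure := h ▸ trivial
  exact this

/-- Convolution with an exponential extracts a Fourier coefficient. -/
theorem convCLM_isExponential {χ : C(K, ℂ)} (hχ : IsExponential χ) (f : C(K, ℂ)) :
    convCLM μ χ f = (∫ y, f y * χ y ∂μ) • (⟨fun x => χ (-x), by fun_prop⟩ : C(K, ℂ)) := by
  ext x
  rw [convCLM_apply, ← integral_add_left_eq_self _ (-x)]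
  simp only [hχ.2, add_neg_cancel_left, ContinuousMap.coe_smul, Pi.smul_apply,
    ContinuousMap.coe_mk, smul_eq_mul]
  rw [← integral_mul_const]
  congr 1 with y
  ring

/-- Every continuous function is a uniform limit of its convolutions, with kernels that approximate the
Dirac mass at `0`. -/
theorem mem_closure_range_convCLM [T2Space K] (f : C(K, ℂ)) :
    f ∈ closure (Set.range fun c => convCLM μ c f) := by
  refine Metric.mem_closure_iff.2 fun ε hε => ?_
  have hO : {y : K | ‖translationCLM K y f - f‖ < ε / 2} ∈ 𝓝 (0 : K) := by
    refine (isOpen_lt (by have := continuous_translationCLM_apply f; fun_prop)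
      continuous_const).mem_nhds ?_
    simp [translationCLM_zero, hε]
  obtain ⟨O, hO, hOo, h0O⟩ := mem_nhds_iff.1 hO
  obtain ⟨e, he0, he1, he⟩ := exists_continuous_zero_one_of_isClosed hOo.isClosed_compl
    (isClosed_singleton (x := (0 : K))) (by simpa using h0O)
  have hI : 0 < ∫ y, e y ∂μ :=
    e.continuous.integral_pos_of_hasCompactSupport_nonneg_nonzero
      (HasCompactSupport.of_compactSpace _) (fun y => (he y).1)
      (x := 0) (by simp [he1 (Set.mem_singleton (0 : K))])
  set I := ∫ y, e y ∂μ
  let c : C(K, ℂ) := ⟨fun y => ((e y / I : ℝ) : ℂ), by fun_prop⟩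
  refine ⟨_, ⟨c, rfl⟩, lt_of_le_of_lt ?_ (half_lt_self hε)⟩
  have hint : Integrable (fun y => e y / I) μ := integrable_of_continuous (by fun_prop)
  have hc1 : ∫ y, c y ∂μ = 1 := by
    change ∫ y, ((e y / I : ℝ) : ℂ) ∂μ = 1
    rw [integral_complex_ofReal, integral_div, div_self hI.ne', Complex.ofReal_one]
  have hsub : convCLM μ c f - f = ∫ y, c y • (translationCLM K y f - f) ∂μ := by
    simp only [smul_sub]
    rw [integral_sub (integrable_smul_translation μ c f)
      (integrable_of_continuous (by fun_prop)), integral_smul_const, hc1, one_smul, convCLM_eq]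
  rw [dist_comm, dist_eq_norm, hsub]
  calc ‖∫ y, c y • (translationCLM K y f - f) ∂μ‖ ≤ ∫ y, e y / I * (ε / 2) ∂μ := by
        refine norm_integral_le_of_norm_le (hint.mul_const _) (.of_forall fun y => ?_)
        have hc : ‖c y‖ = e y / I := by
          change ‖((e y / I : ℝ) : ℂ)‖ = _
          rw [Complex.norm_real, Real.norm_of_nonneg (div_nonneg (he y).1 hI.le)]
        rw [norm_smul, hc]
        by_cases hy : y ∈ O
        · exact mul_le_mul_of_nonneg_left (hO hy).le (div_nonneg (he y).1 hI.le)
        · simp [he0 hy]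
    _ = ε / 2 := by
        rw [integral_mul_const, integral_div, div_self hI.ne', one_mul]

/-- Spectral synthesis on a compact abelian group: a continuous function is a uniform limit of linear
combinations of the exponentials that occur in its Fourier expansion. -/
theorem mem_closure_span_isExponential [T2Space K] [μ.IsNegInvariant] (f : C(K, ℂ)) :
    f ∈ closure (Submodule.span ℂ {χ : C(K, ℂ) | IsExponential χ ∧ ∫ y, f y * χ (-y) ∂μ ≠ 0} :
      Set C(K, ℂ)) := by
  set S := Submodule.span ℂ {χ : C(K, ℂ) | IsExponential χ ∧ ∫ y, f y * χ (-y) ∂μ ≠ 0}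
  refine closure_minimal ?_ isClosed_closure (mem_closure_range_convCLM μ f)
  rintro _ ⟨c, rfl⟩
  let L : C(K, ℂ) →L[ℂ] C(K, ℂ) := (convCLM μ).flip f
  refine map_mem_closure (f := L) L.continuous (dense_span_isExponential μ c) ?_
  refine fun d hd => (Submodule.span_le (p := S.comap L.toLinearMap)).2 ?_ hd
  intro χ hχ
  change convCLM μ χ f ∈ S
  rw [convCLM_isExponential μ hχ]
  by_cases h0 : ∫ y, f y * χ y ∂μ = 0
  · rw [h0, zero_smul]; exact zero_mem _
  · exact Submodule.smul_mem _ _ (Submodule.subset_span ⟨hχ.comp_neg, by simpa using h0⟩)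

end Compact

/-! ### Compact open subgroups -/

variable {G : Type*} [AddCommGroup G] [TopologicalSpace G] [IsTopologicalAddGroup G]

theorem exists_isCompact_closure_finset_subset (h : ∀ x : G, IsCompactElem x) (t : Finset G) :
    ∃ Q : Set G, IsCompact Q ∧ (AddSubgroup.closure (t : Set G) : Set G) ⊆ Q := by
  classical
  induction t using Finset.induction_on with
  | empty => exact ⟨{0}, isCompact_singleton, by simp⟩
  | insert x t _ ih =>
    obtain ⟨Q, hQ, hsub⟩ := ih
    refine ⟨_, (h x).add hQ, ?_⟩
    rw [Finset.coe_insert, Set.insert_eq, AddSubgroup.closure_union, AddSubgroup.normal_add,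
      ← AddSubgroup.zmultiples_eq_closure]
    exact Set.add_subset_add (AddSubgroup.le_topologicalClosure _) hsub

/-- In a locally compact abelian group of compact elements, every compact set lies in a compact open
subgroup. -/
theorem exists_isOpen_isCompact_addSubgroup [LocallyCompactSpace G]
    (h : ∀ x : G, IsCompactElem x) {C : Set G} (hC : IsCompact C) :
    ∃ K : AddSubgroup G, IsOpen (K : Set G) ∧ IsCompact (K : Set G) ∧ C ⊆ K := by
  obtain ⟨F, hF, hCF⟩ := exists_compact_superset (hC.insert 0)
  set S : Set G := F ∪ -F with hS
  have hSc : IsCompact S := hF.union hF.neg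
  have hSn : ∀ x ∈ S, -x ∈ S := fun x hx => by
    rcases hx with hx | hx
    · exact Or.inr (by simpa using hx)
    · exact Or.inl hx
  have h0 : S ∈ 𝓝 (0 : G) := mem_of_superset
    (isOpen_interior.mem_nhds (hCF (Set.mem_insert 0 C)))
    (interior_subset.trans Set.subset_union_left)
  obtain ⟨t, -, ht⟩ := (hSc.add hSc).elim_nhds_subcover (fun x => x +ᵥ S) (fun x _ => by
    simpa using vadd_mem_nhds_vadd x h0)
  obtain ⟨Q, hQ, htQ⟩ := exists_isCompact_closure_finset_subset h t
  set K := AddSubgroup.closure S with hK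
  have hopen : IsOpen (K : Set G) :=
    K.isOpen_of_mem_nhds (mem_of_superset h0 AddSubgroup.subset_closure)
  have hsub : (K : Set G) ⊆ S + (AddSubgroup.closure (t : Set G) : Set G) := by
    have hadd : ∀ x ∈ S + (AddSubgroup.closure (t : Set G) : Set G), ∀ s ∈ S,
        x + s ∈ S + (AddSubgroup.closure (t : Set G) : Set G) := by
      rintro _ ⟨a, ha, l, hl, rfl⟩ s hs
      obtain ⟨y, hy, hmem⟩ := Set.mem_iUnion₂.1 (ht (Set.add_mem_add ha hs))
      obtain ⟨b, hb, hbe⟩ := hmem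
      refine ⟨b, hb, y + l, add_mem (AddSubgroup.subset_closure hy) hl, ?_⟩
      have : y + b = a + s := hbe
      calc b + (y + l) = (y + b) + l := by abel
        _ = a + l + s := by rw [this]; abel
    intro x hx
    induction hx using AddSubgroup.closure_induction_right with
    | zero => exact ⟨0, mem_of_mem_nhds h0, 0, zero_mem _, add_zero 0⟩
    | add_right x _ y hy ih => exact hadd x ih y hy
    | add_neg_cancel x _ y hy ih => exact hadd x ih _ (hSn y hy)
  refine ⟨K, hopen, (hSc.add hQ).of_isClosed_subset (K.isClosed_of_isOpen hopen)
    (hsub.trans (Set.add_subset_add_left htQ)), fun x hx => AddSubgroup.subset_closure (Or.inl ?_)⟩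
  exact interior_subset (hCF (Set.mem_insert_of_mem 0 hx))

theorem IsCompactElem.exists_nsmul_mem {x : G} (hx : IsCompactElem x) {K : AddSubgroup G}
    (hK : IsOpen (K : Set G)) : ∃ n : ℕ, n ≠ 0 ∧ n • x ∈ K := by
  have := QuotientAddGroup.discreteTopology hK
  have hfin := (hx.image (QuotientAddGroup.continuous_mk (N := K))).finite_of_discrete
  have hmem : ∀ n : ℕ, ((n • x : G) : G ⧸ K) ∈ ((fun y : G => (y : G ⧸ K)) ''
      ((AddSubgroup.zmultiples x).topologicalClosure : Set G)) := fun n =>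
    ⟨n • x, AddSubgroup.le_topologicalClosure _ (AddSubgroup.nsmul_mem_zmultiples x n), rfl⟩
  obtain ⟨i, -, j, -, hij, he⟩ := Set.infinite_univ.exists_ne_map_eq_of_mapsTo
    (fun n _ => hmem n) hfin
  wlog hlt : i < j generalizing i j
  · exact this j i hij.symm he.symm (lt_of_le_of_ne (not_lt.1 hlt) hij.symm)
  refine ⟨j - i, (Nat.sub_pos_of_lt hlt).ne', ?_⟩
  have := QuotientAddGroup.eq.1 he
  rwa [← Nat.sub_add_cancel hlt.le, add_nsmul, neg_add_eq_sub, add_sub_cancel_right] at this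

/-! ### Extending exponentials from an open subgroup -/

/-- The `ψ`-isotypic part of `V`: the elements `g` of `V` with `g (x + k) = ψ k * g x` for `k ∈ K`.
They are regarded as plain functions on `G`. -/
def isotypic (V : Submodule ℂ C(G, ℂ)) (K : AddSubgroup G) (ψ : C(K, ℂ)) :
    Submodule ℂ (G → ℂ) where
  carrier := {g | (∃ f ∈ V, ⇑f = g) ∧ ∀ (x : G) (k : K), g (x + k) = ψ k * g x}
  zero_mem' := ⟨⟨0, zero_mem _, rfl⟩, by simp⟩
  add_mem' := by
    rintro _ _ ⟨⟨f, hf, rfl⟩, h1⟩ ⟨⟨g, hg, rfl⟩, h2⟩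
    exact ⟨⟨f + g, add_mem hf hg, rfl⟩, fun x k => by simp [h1, h2, mul_add]⟩
  smul_mem' := by
    rintro c _ ⟨⟨f, hf, rfl⟩, h1⟩
    exact ⟨⟨c • f, Submodule.smul_mem _ _ hf, rfl⟩, fun x k => by simp [h1, mul_left_comm]⟩

theorem comp_add_right_mem_isotypic {V : Submodule ℂ C(G, ℂ)} (hV : IsVariety V)
    {K : AddSubgroup G} {ψ : C(K, ℂ)} (y : G) {g : G → ℂ} (hg : g ∈ isotypic V K ψ) :
    (fun x => g (x + y)) ∈ isotypic V K ψ := by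
  obtain ⟨⟨f, hf, rfl⟩, h⟩ := hg
  refine ⟨⟨translate y f, hV.translate_mem y f hf, rfl⟩, fun x k => ?_⟩
  change f (x + k + y) = ψ k * f (x + y)
  rw [add_right_comm, h]

/-- Translation by `y` as an endomorphism of the isotypic part. -/
def isotypicTranslation {V : Submodule ℂ C(G, ℂ)} (hV : IsVariety V) (K : AddSubgroup G)
    (ψ : C(K, ℂ)) (y : G) : Module.End ℂ (isotypic V K ψ) where
  toFun g := ⟨_, comp_add_right_mem_isotypic hV y g.2⟩
  map_add' _ _ := rfl
  map_smul' _ _ := rfl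

section Extension

variable {V : Submodule ℂ C(G, ℂ)} (hV : IsVariety V) {K : AddSubgroup G} {ψ : C(K, ℂ)}

@[simp] theorem isotypicTranslation_apply (y : G) (g : isotypic V K ψ) (x : G) :
    (isotypicTranslation hV K ψ y g : G → ℂ) x = (g : G → ℂ) (x + y) := rfl

theorem isotypicTranslation_add (y z : G) : isotypicTranslation hV K ψ (y + z) =
    isotypicTranslation hV K ψ y * isotypicTranslation hV K ψ z := by
  ext g x
  simp [add_assoc]

theorem isotypicTranslation_zero : isotypicTranslation hV K ψ 0 = 1 := by
  ext g x
  simp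

theorem isotypicTranslation_nsmul (n : ℕ) (y : G) :
    isotypicTranslation hV K ψ (n • y) = isotypicTranslation hV K ψ y ^ n := by
  induction n with
  | zero => rw [zero_smul, pow_zero, isotypicTranslation_zero]
  | succ n ih => rw [succ_nsmul, isotypicTranslation_add, ih, pow_succ]

theorem isotypicTranslation_coe (k : K) :
    isotypicTranslation hV K ψ k = algebraMap ℂ _ (ψ k) := by
  ext g x
  exact g.2.2 x k

/-- A power of the translation by `y` is the translation by an element of `K`, which acts on the
isotypic part as a scalar. -/
theorem isIntegral_isotypicTranslation {y : G} (hy : ∃ n : ℕ, n ≠ 0 ∧ n • y ∈ K) :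
    IsIntegral ℂ (isotypicTranslation hV K ψ y) := by
  obtain ⟨n, hn, hmem⟩ := hy
  refine IsIntegral.of_pow (Nat.pos_of_ne_zero hn) ?_
  rw [← isotypicTranslation_nsmul, isotypicTranslation_coe hV ⟨n • y, hmem⟩]
  exact isIntegral_algebraMap

end Extension

/-- If the isotypic part of `ψ` in `V` is nonzero, then `ψ` extends to an exponential in `V`, obtained
from a character of the algebra generated by the translations of the isotypic part. -/
theorem exists_isExponential_mem_of_isotypic_ne_bot {V : Submodule ℂ C(G, ℂ)}
    (hV : IsVariety V) {K : AddSubgroup G} {ψ : C(K, ℂ)} (hK : IsOpen (K : Set G))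
    (htors : ∀ y : G, ∃ n : ℕ, n ≠ 0 ∧ n • y ∈ K)
    (hne : isotypic V K ψ ≠ ⊥) :
    ∃ m ∈ V, IsExponential m ∧ ∀ k : K, m k = ψ k := by
  let τ := isotypicTranslation hV K ψ
  have : Nontrivial (isotypic V K ψ) := Submodule.nontrivial_iff_ne_bot.2 hne
  obtain ⟨φ⟩ := nonempty_algHom_adjoin_of_isIntegral (s := Set.range τ)
    (by
      rintro _ ⟨y, rfl⟩ _ ⟨z, rfl⟩
      change τ y * τ z = τ z * τ y
      rw [← isotypicTranslation_add, ← isotypicTranslation_add, add_comm])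
    (by
      rintro _ ⟨y, rfl⟩
      exact isIntegral_isotypicTranslation hV (htors y))
  let T : G → Algebra.adjoin ℂ (Set.range τ) := fun y =>
    ⟨τ y, Algebra.subset_adjoin (Set.mem_range_self y)⟩
  let m : G → ℂ := fun y => φ (T y)
  have hm0 : m 0 = 1 := by
    have : T 0 = 1 := Subtype.ext (isotypicTranslation_zero hV)
    simp only [m, this, map_one]
  have hmadd : ∀ y z, m (y + z) = m y * m z := fun y z => by
    have : T (y + z) = T y * T z := Subtype.ext (isotypicTranslation_add hV y z)
    simp only [m, this, map_mul]
  have hmK : ∀ k : K, m k = ψ k := fun k => by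
    have : T k = algebraMap ℂ _ (ψ k) := Subtype.ext (isotypicTranslation_coe hV k)
    simp only [m, this, AlgHom.commutes]
    rfl
  have hmne : ∀ y, m y ≠ 0 := fun y h0 => by
    have := hmadd y (-y)
    rw [add_neg_cancel, hm0, h0, zero_mul] at this
    exact one_ne_zero this
  have hcont0 : ContinuousAt m 0 := by
    refine (hK.isOpenEmbedding_subtypeVal.continuousAt_iff (x := (0 : K))).1 ?_
    have : m ∘ (Subtype.val : K → G) = ψ := funext hmK
    exact this ▸ ψ.continuous.continuousAt
  have hcont : Continuous m := continuous_iff_continuousAt.2 fun x₀ => by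
    have h1 : m = fun x => m x₀ * m (x - x₀) := funext fun x => by
      rw [← hmadd, add_sub_cancel]
    rw [h1]
    refine continuousAt_const.mul
      (ContinuousAt.comp (g := m) (f := fun x => x - x₀) ?_ (by fun_prop))
    rwa [sub_self]
  -- A linear functional that separates `m` from the isotypic part on `t` would be a linear relation
  -- between translations that `φ` does not respect.
  have hfin : ∀ t : Finset G, ∃ g ∈ isotypic V K ψ, ∀ x ∈ t, g x = m x := by
    intro t
    let E : isotypic V K ψ →ₗ[ℂ] (t → ℂ) :=
      { toFun := fun g x => (g : G → ℂ) x
        map_add' := fun _ _ => rfl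
        map_smul' := fun _ _ => rfl }
    suffices h : (fun x : t => m x) ∈ LinearMap.range E by
      obtain ⟨g, hg⟩ := h
      exact ⟨g, g.2, fun x hx => congrFun hg ⟨x, hx⟩⟩
    by_contra hnot
    obtain ⟨f, hf, hle⟩ := Submodule.exists_le_ker_of_notMem hnot
    classical
    let c : t → ℂ := fun x => f (Pi.single x 1)
    have hfc : ∀ v : t → ℂ, f v = ∑ x, v x * c x := fun v => by
      rw [f.pi_apply_eq_sum_univ v]
      simp only [smul_eq_mul, c]
      congr! 4 with x _ y
      simp [Pi.single_apply, eq_comm]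
    have hrel : ∑ x : t, c x • T x = 0 := by
      refine Subtype.ext ?_
      ext g y
      have h1 := hle ⟨τ y g, rfl⟩
      rw [LinearMap.mem_ker, hfc] at h1
      simp only [E, LinearMap.coe_mk, AddHom.coe_mk] at h1
      simp only [AddSubmonoidClass.coe_finsetSum, LinearMap.sum_apply, Finset.sum_apply]
      refine Eq.trans (Finset.sum_congr rfl fun x _ => ?_) h1
      change c x * (g : G → ℂ) (y + x) = (g : G → ℂ) (x + y) * c x
      rw [add_comm, mul_comm]
    refine hf ?_
    have h2 := congrArg φ hrel
    rw [map_sum, map_zero] at h2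
    rw [hfc, ← h2]
    refine Finset.sum_congr rfl fun x _ => ?_
    rw [map_smul, smul_eq_mul, mul_comm]
  refine ⟨⟨m, hcont⟩, ?_, ⟨hmne, hmadd⟩, hmK⟩
  have hcl : (⟨m, hcont⟩ : C(G, ℂ)) ∈ closure (V : Set C(G, ℂ)) := by
    refine mem_closure_of_forall_isCompact fun C hC ε hε => ?_
    -- The finite set `t` meets every coset of `K` that meets `C`, so the values on `t` determine both
    -- `m` and the elements of the isotypic part on `C`.
    obtain ⟨t, -, ht⟩ := hC.elim_nhds_subcover (fun x => x +ᵥ (K : Set G)) (fun x _ => by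
      simpa using vadd_mem_nhds_vadd x (hK.mem_nhds K.zero_mem))
    obtain ⟨g, hg, hgt⟩ := hfin t
    obtain ⟨⟨f, hf, rfl⟩, hgK⟩ := hg
    refine ⟨f, hf, fun x hx => ?_⟩
    obtain ⟨y, hy, k, hk, rfl⟩ := Set.mem_iUnion₂.1 (ht hx)
    have h1 : f (y + k) = m (y + k) := by
      rw [hmadd, hgK y ⟨k, hk⟩, ← hmK, hgt y hy, mul_comm]
    change dist (m (y + k)) (f (y + k)) < ε
    rwa [h1, dist_self]
  rwa [hV.isClosed.closure_eq] at hcl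

/-- A variety contains the averages of its elements over a compact subgroup, weighted by a continuous
function: on each compact set they are integrals of a continuous family of elements of the variety. -/
theorem IsVariety.exists_mem_eq_integral {V : Submodule ℂ C(G, ℂ)} (hV : IsVariety V)
    {K : AddSubgroup G} [CompactSpace K] [MeasurableSpace K] [BorelSpace K] (μ : Measure K)
    [μ.IsAddHaarMeasure] [IsProbabilityMeasure μ] (c : C(K, ℂ)) {f : C(G, ℂ)} (hf : f ∈ V) :
    ∃ g ∈ V, ∀ x, g x = ∫ k : K, c k * f (x + k) ∂μ := by
  let F : C(G, C(K, ℂ)) := ContinuousMap.curry ⟨fun p : G × K => f (p.1 + p.2), by fun_prop⟩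
  let g : C(G, ℂ) := ⟨fun x => convCLM μ c (F x) 0, by fun_prop⟩
  have hg : ∀ x, g x = ∫ k : K, c k * f (x + k) ∂μ := fun x => by
    change convCLM μ c (F x) 0 = _
    rw [convCLM_apply]
    simp [F]
  refine ⟨g, ?_, hg⟩
  suffices h : g ∈ closure (V : Set C(G, ℂ)) by rwa [hV.isClosed.closure_eq] at h
  refine mem_closure_of_forall_isCompact fun C hC ε hε => ?_
  have := isCompact_iff_compactSpace.1 hC
  let Φ : K → C(C, ℂ) := fun k => (translate (k : G) f).restrict C
  have hΦ : Continuous Φ := ContinuousMap.continuous_of_continuous_uncurry _ (by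
    change Continuous fun p : K × C => f ((p.2 : G) + p.1)
    fun_prop)
  have hint : Integrable (fun k => c k • Φ k) μ :=
    integrable_of_continuous ((map_continuous c).smul hΦ)
  have hconv : Convex ℝ ((fun h : C(G, ℂ) => h.restrict C) '' (V : Set C(G, ℂ))) := by
    rintro _ ⟨u, hu, rfl⟩ _ ⟨v, hv, rfl⟩ a b - - -
    refine ⟨(a : ℂ) • u + (b : ℂ) • v,
      V.add_mem (V.smul_mem _ hu) (V.smul_mem _ hv), ?_⟩
    ext x
    simp
  have hmem := hconv.closure.integral_mem isClosed_closure (μ := μ) (.of_forall fun k =>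
    subset_closure ⟨c k • translate (k : G) f,
      V.smul_mem _ (hV.translate_mem _ f hf), rfl⟩) hint
  obtain ⟨_, ⟨h, hh, rfl⟩, hlt⟩ := Metric.mem_closure_iff.1 hmem ε hε
  refine ⟨h, hh, fun x hx => lt_of_le_of_lt ?_ hlt⟩
  have heval : (∫ k, c k • Φ k ∂μ) ⟨x, hx⟩ = g x := by
    rw [hg]
    exact (ContinuousLinearMap.integral_comp_comm (𝕜 := ℂ) (E := C(C, ℂ)) (Fₗ := ℂ)
      (ContinuousMap.evalCLM ℂ ⟨x, hx⟩) hint).symm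
  rw [← heval]
  exact ContinuousMap.dist_apply_le_dist (g := h.restrict C) ⟨x, hx⟩

/-- An exponential of a compact open subgroup that occurs in the Fourier expansion of some `f ∈ V` over
that subgroup extends to an exponential in `V`. -/
theorem IsVariety.exists_isExponential_extension {V : Submodule ℂ C(G, ℂ)} (hV : IsVariety V)
    {K : AddSubgroup G} [CompactSpace K] [MeasurableSpace K] [BorelSpace K] (μ : Measure K)
    [μ.IsAddHaarMeasure] [IsProbabilityMeasure μ] (hK : IsOpen (K : Set G))
    (htors : ∀ y : G, ∃ n : ℕ, n ≠ 0 ∧ n • y ∈ K) {f : C(G, ℂ)} (hf : f ∈ V)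
    {ψ : C(K, ℂ)} (hψ : IsExponential ψ) (hne : ∫ k : K, f k * ψ (-k) ∂μ ≠ 0) :
    ∃ m ∈ V, IsExponential m ∧ ∀ k : K, m k = ψ k := by
  refine exists_isExponential_mem_of_isotypic_ne_bot hV hK htors fun hbot => hne ?_
  obtain ⟨g, hg, hgx⟩ := hV.exists_mem_eq_integral μ ⟨fun k => ψ (-k), by fun_prop⟩ hf
  have hiso : ⇑g ∈ isotypic V K ψ := by
    refine ⟨⟨g, hg, rfl⟩, fun x j => ?_⟩
    rw [hgx, hgx, ← integral_const_mul,
      ← integral_add_left_eq_self (fun k : K => ψ j * (_ * f (x + k))) j]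
    refine integral_congr_ae (.of_forall fun k => ?_)
    change ψ (-k) * f (x + j + k) = ψ j * (ψ (-(j + k)) * f (x + ((j + k : K) : G)))
    rw [neg_add, hψ.2, ← mul_assoc, ← mul_assoc, ← hψ.2, add_neg_cancel, hψ.map_zero, one_mul,
      AddSubgroup.coe_add, add_assoc]
  rw [hbot, Submodule.mem_bot] at hiso
  have h0 := congrFun hiso 0
  rw [hgx] at h0
  simpa [mul_comm] using h0

/-! ### Spectral synthesis on groups of compact elements -/

theorem holdsOn_of_forall_isCompactElem [LocallyCompactSpace G] [T2Space G]
    (h : ∀ x : G, IsCompactElem x) : HoldsOn G := by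
  intro V hV f hf
  refine mem_closure_of_forall_isCompact fun C hC ε hε => ?_
  obtain ⟨K, hKo, hKc, hCK⟩ := exists_isOpen_isCompact_addSubgroup h hC
  have : CompactSpace K := isCompact_iff_compactSpace.1 hKc
  let _ : MeasurableSpace K := borel K
  have : BorelSpace K := ⟨rfl⟩
  let μ : Measure K := Measure.addHaarMeasure ⊤
  have : IsProbabilityMeasure μ := ⟨Measure.addHaarMeasure_self (K₀ := ⊤)⟩
  obtain ⟨u, hu, hlt⟩ := Metric.mem_closure_iff.1
    (mem_closure_span_isExponential μ (f.restrict K)) ε hε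
  have hlift : ∃ p ∈ Submodule.span ℂ {f : C(G, ℂ) | f ∈ V ∧ IsExponentialMonomial f},
      ∀ k : K, p k = u k := by
    clear hlt
    induction hu using Submodule.span_induction with
    | mem ψ hψ =>
      obtain ⟨m, hm, hme, hmK⟩ := hV.exists_isExponential_extension μ hKo
        (fun y => (h y).exists_nsmul_mem hKo) hf hψ.1 hψ.2
      exact ⟨m, Submodule.subset_span ⟨hm, hme.isExponentialMonomial⟩, hmK⟩
    | zero => exact ⟨0, zero_mem _, fun _ => rfl⟩
    | add u v _ _ hu hv =>
      obtain ⟨p, hp, hpu⟩ := hu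
      obtain ⟨q, hq, hqv⟩ := hv
      exact ⟨p + q, add_mem hp hq, fun k => by simp [hpu, hqv]⟩
    | smul a u _ hu =>
      obtain ⟨p, hp, hpu⟩ := hu
      exact ⟨a • p, Submodule.smul_mem _ _ hp, fun k => by simp [hpu]⟩
  obtain ⟨p, hp, hpu⟩ := hlift
  refine ⟨p, hp, fun x hx => ?_⟩
  have := hpu ⟨x, hCK hx⟩
  rw [this]
  exact (ContinuousMap.dist_apply_le_dist (f := f.restrict K) ⟨x, hCK hx⟩).trans_lt hlt

end SpectralSynthesis

theorem mainTheorem8 {G : Type*} [AddCommGroup G] [TopologicalSpace G] [IsTopologicalAddGroup G]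
    [LocallyCompactSpace G] [T2Space G]
    (h : ∀ x : G, SpectralSynthesis.IsCompactElem x) :
    SpectralSynthesis.HoldsOn G := SpectralSynthesis.holdsOn_of_forall_isCompactElem h
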